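/- **Setting.** Let $K$ and $L$ be groups with isomorphic subgroups identified with one group $H$ (so $K\cap L=H$), and let $L^*=K*_H L$ be their free product with amalgamation over $H$; $K$ and $L$ are regarded as subgroups of $L^*$. A *normal form* of $w\in L^*$, $w\neq 1$, is a sequence $g_1\dots g_n$ ($n\ge 1$) of elements of $K\cup L$ with product $w$ such that $g_i,g_{i+1}$ belong to different factors for $1\le i<n$ and, if $n\ne1$, no $g_i$ belongs to $H$. The number $n=|w|$ depends only on $w$ and is the *length* of $w$; the identity has the empty normal form and $|1|=0$. A word $w$ with normal form $g_1\dots g_n$ is *weakly cyclically reduced* if $n\le 1$ or $g_ng_1\notin H$. A representation $w=uv$ is *semireduced* if $u=1$, or $v=1$, or the last letter $g$ of a normal form of $u$ and the first letter $g'$ of a normal form of $v$ satisfy $gg'\notin H$. A set $R\subset L^*$ is *symmetrized* if every $r\in R$ is weakly cyclically reduced and all weakly cyclically reduced conjugates of $r$ and $r^{-1}$ belong to $R$; the *symmetrized closure* of an element is the least symmetrized set containing it. A word $b$ is a *piece* with respect to $R$ if there are different $r,r'\in R$ and $c,c'\in L^*$ such that $r=bc$ and $r'=bc'$ are semireduced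 representations. A symmetrized set $R$ satisfies $C'(\lambda)$, where $\lambda>0$, if $|b|<\lambda|r|$ whenever $r\in R$ has a semireduced representation $r=bc$ with $b$ a piece, and $|r|>1/\lambda$ for all $r\in R$. Elements $x,y\in K$ are *good fellows over $H$* if $x,y\in K\setminus H$ and $Hx^{\varepsilon}H\cap Hy^{\delta}H=\varnothing$ for all $\varepsilon,\delta\in\{1,-1\}$. **Lemma A.2.** Let $x,y\in K$ be good fellows over $H$, let $a\in L\setminus H$ satisfy $a^{-1}Ha\cap H=\{1\}$, and let $h\in K\setminus H$. Let $R\subset L^*$ be the symmetrized closure of $$r_0=h\,a\;ya\;xa\,(ya)^2\;xa\,(ya)^3\cdots xa\,(ya)^{80}.$$ Then $R$ is symmetrized and satisfies the small cancellation condition $C'(1/10)$. Moreover, every piece with respect to $R$ has length at most $601$, and every element of $R$ has length $6640$ or $6641$. -/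

import Mathlib

universe u

/-- Two elements `x`, `y` of a group `G` are good fellows over a subgroup `H` if they lie outside
`H` and the double cosets `H x^ε H` and `H y^δ H` are disjoint for all `ε, δ = ±1`. -/
def GoodFellows {G : Type u} [Group G] (H : Subgroup G) (x y : G) : Prop :=
  x ∉ H ∧ y ∉ H ∧ ∀ ε δ : ℤˣ,
    Disjoint (DoubleCoset.doubleCoset (x ^ (ε : ℤ)) (H : Set G) (H : Set G))
      (DoubleCoset.doubleCoset (y ^ (δ : ℤ)) (H : Set G) (H : Set G))

namespace Amalgam

/-- The two-element family of groups `K`, `L`. -/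
def Factor (K L : Type u) : Bool → Type u
  | false => K
  | true => L

instance (K L : Type u) [Group K] [Group L] : ∀ i, Group (Factor K L i)
  | false => inferInstanceAs (Group K)
  | true => inferInstanceAs (Group L)

variable {K L : Type u} [Group K] [Group L] {H : Subgroup K} {H' : Subgroup L}

/-- The embeddings of the amalgamated subgroup `H` in `K` (the inclusion) and in `L` (the
isomorphism `φ : H ≃* H'` followed by the inclusion). -/
def incl (φ : H ≃* H') : ∀ i, H →* Factor K L i
  | false => H.subtype
  | true => H'.subtype.comp φ.toMonoidHom

/-- The free product of `K` and `L` with the subgroups `H` of `K` and `H'` of `L` amalgamated by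
the isomorphism `φ`: Mathlib's pushout of groups, for the two-element family `K`, `L`. -/
abbrev AmalgamatedProduct (φ : H ≃* H') : Type u := Monoid.PushoutI (incl φ)

/-- The natural homomorphism from `K`. -/
def ofLeft (φ : H ≃* H') : K →* AmalgamatedProduct φ :=
  Monoid.PushoutI.of (φ := incl φ) false

/-- The natural homomorphism from `L`. -/
def ofRight (φ : H ≃* H') : L →* AmalgamatedProduct φ :=
  Monoid.PushoutI.of (φ := incl φ) true

/-- The copy of `K` in the amalgamated product. -/
def left (φ : H ≃* H') : Subgroup (AmalgamatedProduct φ) := (ofLeft φ).range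

/-- The copy of `L` in the amalgamated product. -/
def right (φ : H ≃* H') : Subgroup (AmalgamatedProduct φ) := (ofRight φ).range

/-- The copy of the amalgamated subgroup `H` in the amalgamated product. -/
def base (φ : H ≃* H') : Subgroup (AmalgamatedProduct φ) := H.map (ofLeft φ)

variable {φ : H ≃* H'}

/-- The list of letters `l` is a normal form of `w`: its product is `w`, its terms lie in `K ∪ L`,
consecutive terms lie in different factors, and if there is not exactly one term, then no term lies
in `H`. The last clause makes the empty list the only normal form of the identity. -/
structure IsNormalForm (l : List (AmalgamatedProduct φ)) (w : AmalgamatedProduct φ) : Prop where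
  prod_eq : l.prod = w
  letter : ∀ g ∈ l, g ∈ left φ ∨ g ∈ right φ
  alternating : l.IsChain fun g g' =>
    (g ∈ left φ ∧ g' ∈ right φ) ∨ (g ∈ right φ ∧ g' ∈ left φ)
  notMem_base : l.length ≠ 1 → ∀ g ∈ l, g ∉ base φ
  ne_one : l ≠ [1]

/-- The length `|w|`: the number of letters in a normal form of `w` (all normal forms of `w` have
the same number of letters, so the infimum is over a singleton). -/
noncomputable def length (w : AmalgamatedProduct φ) : ℕ :=
  sInf {n | ∃ l, IsNormalForm l w ∧ l.length = n}

/-- `w` is weakly cyclically reduced: it has a normal form `g₁ … gₙ` with `n ≤ 1` or `gₙ g₁ ∉ H`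
(the choice of the normal form does not matter). -/
def IsWeaklyCyclicallyReduced (w : AmalgamatedProduct φ) : Prop :=
  ∃ l, IsNormalForm l w ∧
    (l.length ≤ 1 ∨ ∀ g ∈ l.getLast?, ∀ g' ∈ l.head?, g * g' ∉ base φ)

/-- The product `u v` is semireduced: the last letter `g` of `u` and the first letter `g'` of `v`
do not cancel, that is, `g g' ∉ H`; they may merge. There is no cancellation when `u = 1` or
`v = 1`. -/
def IsSemireduced (u v : AmalgamatedProduct φ) : Prop :=
  ∀ l m, IsNormalForm l u → IsNormalForm m v →
    ∀ g ∈ l.getLast?, ∀ g' ∈ m.head?, g * g' ∉ base φ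

/-- A set is symmetrized if each of its elements `r` is weakly cyclically reduced and it contains
all weakly cyclically reduced conjugates of `r` and `r⁻¹`. -/
def IsSymmetrized (R : Set (AmalgamatedProduct φ)) : Prop :=
  ∀ r ∈ R, IsWeaklyCyclicallyReduced r ∧
    ∀ s, IsWeaklyCyclicallyReduced s → IsConj r s ∨ IsConj r⁻¹ s → s ∈ R

/-- The symmetrized closure of `r`: the least symmetrized set that contains `r`. -/
def symmetrizedClosure (r : AmalgamatedProduct φ) : Set (AmalgamatedProduct φ) :=
  ⋂₀ {S | IsSymmetrized S ∧ r ∈ S}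

/-- `b` is a piece with respect to `R`: two different elements of `R` have semireduced
representations `b c` and `b c'`. -/
def IsPiece (R : Set (AmalgamatedProduct φ)) (b : AmalgamatedProduct φ) : Prop :=
  ∃ r ∈ R, ∃ r' ∈ R, r ≠ r' ∧ ∃ c c', r = b * c ∧ r' = b * c' ∧
    IsSemireduced b c ∧ IsSemireduced b c'

/-- `R` is a symmetrized set that satisfies the small cancellation condition `C'(lam)`. -/
def SmallCancellation (lam : ℝ) (R : Set (AmalgamatedProduct φ)) : Prop :=
  IsSymmetrized R ∧
  (∀ r ∈ R, ∀ b c, IsPiece R b → r = b * c → IsSemireduced b c →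
    (length b : ℝ) < lam * length r) ∧
  ∀ r ∈ R, 1 / lam < (length r : ℝ)

/-- The word `h a (y a) · x a (y a)² · x a (y a)³ ⋯ x a (y a)⁸⁰`. -/
def relator (φ : H ≃* H') (x y h : K) (a : L) : AmalgamatedProduct φ :=
  ofLeft φ h * ofRight φ a * (ofLeft φ y * ofRight φ a) *
    ((List.range 79).map fun k =>
      ofLeft φ x * ofRight φ a * (ofLeft φ y * ofRight φ a) ^ (k + 2)).prod

end Amalgam

/-! Continue the letters of the relator to a bi-infinite sequence of period 6640, with a fixed
letter `a` at the odd places and letters from `K` at the even ones. Every element of `R` is a period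
of this sequence, or of the reversed inverse sequence, conjugated by one element `b` of the factor
containing its first letter, without cancellation there (`exists_isShift`). Its normal form is the
period with `b` merged into the first letter and `b⁻¹` either absorbed at the end or standing as an
extra letter, whence the lengths 6640 and 6641.

Suppose a piece has at least 602 letters. A semireduced product alters only its last letter, so two
different elements of `R` share their first 601 letters up to intercalated elements of `H`. Hence
600 consecutive letters of the two sequences agree up to double cosets of `H`, and 300 of them come
from `K`. Good fellowship makes the types of `x` and `y` distinguishable, even up to inversion. A
stretch of 300 contains two complete blocks `x y ⋯ y x`, and the number of `y`s in a block fixes its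
place in the period. So the two sequences cannot run in opposite directions, since consecutive
blocks grow in one direction only, and they are in phase (`not_window_reversed`, `dvd_of_window`).
The letter `h` may be of either type, but it never has to be identified.

In phase, the intercalated element `c` before a letter `a` and the one after it, `a⁻¹ c a`, both lie
in `H`, so `a⁻¹ H a ∩ H = 1` gives `c = 1`. Then the two elements of `R` coincide (`eq_of_inPhase`),
a contradiction. Finally 601 < 6640/10. -/

namespace Amalgam

/-! ### Normal forms in an abstract amalgam -/

section Abstract

variable {G : Type u} [Group G]

/-- The letters of `l` lie outside `C`, and alternately in `F i`, `F (!i)`, `F i`, …. -/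
def Alt (F : Bool → Subgroup G) (C : Subgroup G) : Bool → List G → Prop
  | _, [] => True
  | i, g :: l => g ∈ F i ∧ g ∉ C ∧ Alt F C (!i) l

/-- `G` is generated by `F false` and `F true`, which share the subgroup `C`, and no nonempty
alternating product lies in `C`: an internal characterization of free products with
amalgamation. -/
structure IsAmalgam (F : Bool → Subgroup G) (C : Subgroup G) : Prop where
  le : ∀ i, C ≤ F i
  mem_of_mem : ∀ g i, g ∈ F i → g ∈ F (!i) → g ∈ C
  eq_nil : ∀ i l, Alt F C i l → l.prod ∈ C → l = []
  closure_eq_top : Subgroup.closure ((F false : Set G) ∪ F true) = ⊤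

variable {F : Bool → Subgroup G} {C : Subgroup G}

theorem Alt.append_of_last {l : List G} {g : G} {i : Bool} (h : Alt F C i (l ++ [g])) :
    ∃ j, g ∈ F j ∧ g ∉ C ∧ ∀ m, Alt F C j m → Alt F C i (l ++ m) := by
  induction l generalizing i with
  | nil => exact ⟨i, h.1, h.2.1, fun m hm => hm⟩
  | cons u l ih =>
    obtain ⟨j, hj, hg, hm⟩ := ih h.2.2
    exact ⟨j, hj, hg, fun m h' => ⟨h.1, h.2.1, hm m h'⟩⟩

theorem Alt.inv_reverse_append {l m : List G} {i : Bool} (hl : Alt F C i l)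
    (hm : Alt F C (!i) m) : ∃ k, Alt F C k ((l.map (·⁻¹)).reverse ++ m) := by
  induction l generalizing i m with
  | nil => exact ⟨_, hm⟩
  | cons g l ih =>
    obtain ⟨k, hk⟩ := ih (m := g⁻¹ :: m) hl.2.2
      ⟨by simpa using hl.1, by simpa using hl.2.1, by simpa using hm⟩
    exact ⟨k, by simpa using hk⟩

theorem prod_inv_reverse (l : List G) : (l.map (·⁻¹)).reverse.prod = l.prod⁻¹ :=
  (List.prod_inv_reverse l).symm

theorem Alt.mul_head {g : G} {l : List G} {i : Bool} (hF : IsAmalgam F C)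
    (h : Alt F C i (g :: l)) {c : G} (hc : c ∈ C) : Alt F C i (c * g :: l) :=
  ⟨(F i).mul_mem (hF.le i hc) h.1, fun h' => h.2.1 ((C.mul_mem_cancel_left hc).1 h'), h.2.2⟩

/-- Nothing cancels at the junction of the inverse of the first word with the second, as they start
in different factors, so the whole product is alternating. -/
theorem Alt.nil_of_inv_mul_mem (hF : IsAmalgam F C) {l m : List G} {i : Bool}
    (hl : Alt F C i l) (hm : Alt F C (!i) m) (h : l.prod⁻¹ * m.prod ∈ C) : l = [] ∧ m = [] := by
  obtain ⟨k, hk⟩ := hl.inv_reverse_append hm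
  have := hF.eq_nil k _ hk (by rwa [List.prod_append, prod_inv_reverse])
  simpa using this

/-- Uniqueness of normal forms, up to intercalated elements of `C`. -/
theorem Alt.prefix_mem (hF : IsAmalgam F C) {l m : List G} {i k : Bool}
    (hl : Alt F C i l) (hm : Alt F C k m) {c : G} (hc : c ∈ C) (h : l.prod = c * m.prod) :
    l.length = m.length ∧ ∀ j, (l.take j).prod⁻¹ * (c * (m.take j).prod) ∈ C := by
  induction l generalizing i k m c with
  | nil =>
    have : m = [] := hF.eq_nil k m hm (by
      rw [List.prod_nil, eq_comm, ← eq_inv_mul_iff_mul_eq] at h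
      rw [h]; simpa using hc)
    subst this
    simpa using hc
  | cons g l ih =>
    cases m with
    | nil =>
      have := hF.eq_nil i _ hl (by rw [h]; simpa using hc)
      simp at this
    | cons g' m =>
      rw [List.prod_cons, List.prod_cons] at h
      have hik : k = i := by
        by_contra hik
        have hk : k = !i := by revert hik; cases k <;> cases i <;> simp
        subst hk
        have := hl.nil_of_inv_mul_mem hF (hm.mul_head hF hc)
          (by rw [List.prod_cons, List.prod_cons, h]; simp [mul_assoc])
        simp at this
      subst hik
      -- Otherwise this element is a genuine letter in front of the tail of `m`, and the two tails
      -- contradict the case of different starting factors.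
      have hd : g⁻¹ * (c * g') ∈ C := by
        by_contra hd
        have := hl.2.2.nil_of_inv_mul_mem hF (m := g⁻¹ * (c * g') :: m)
          ⟨by
            rw [Bool.not_not]
            exact (F k).mul_mem ((F k).inv_mem hl.1) ((F k).mul_mem (hF.le k hc) hm.1),
            hd, by simpa using hm.2.2⟩
          (by
            rw [List.prod_cons, eq_inv_mul_of_mul_eq h]; simp [mul_assoc])
        simp at this
      have := ih hl.2.2 hm.2.2 hd (by rw [eq_inv_mul_of_mul_eq h]; simp [mul_assoc])
      refine ⟨by simp [this.1], fun j => ?_⟩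
      cases j with
      | zero => simpa using hc
      | succ j => simpa [mul_assoc] using this.2 j

theorem IsAmalgam.exists_alt (hF : IsAmalgam F C) (w : G) :
    ∃ c ∈ C, ∃ i l, Alt F C i l ∧ w = c * l.prod := by
  have step : ∀ i, ∀ g ∈ F i, ∀ w, (∃ c ∈ C, ∃ i l, Alt F C i l ∧ w = c * l.prod) →
      ∃ c ∈ C, ∃ i l, Alt F C i l ∧ g * w = c * l.prod := by
    rintro i g hg w ⟨c, hc, k, l, hl, rfl⟩
    have hg' : g * c ∈ F i := (F i).mul_mem hg (hF.le i hc)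
    by_cases hgc : g * c ∈ C
    · exact ⟨_, hgc, k, l, hl, by simp [mul_assoc]⟩
    cases l with
    | nil => exact ⟨1, C.one_mem, i, [g * c], ⟨hg', hgc, trivial⟩, by simp⟩
    | cons u l =>
      by_cases hik : k = i
      · subst hik
        by_cases hu : g * c * u ∈ C
        · exact ⟨_, hu, _, l, hl.2.2, by simp [mul_assoc]⟩
        · exact ⟨1, C.one_mem, k, g * c * u :: l, ⟨(F k).mul_mem hg' hl.1, hu, hl.2.2⟩,
            by simp [mul_assoc]⟩
      · have hk : k = !i := by revert hik; cases k <;> cases i <;> simp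
        subst hk
        exact ⟨1, C.one_mem, i, g * c :: u :: l, ⟨hg', hgc, hl⟩, by simp [mul_assoc]⟩
  have hw : w ∈ Subgroup.closure ((F false : Set G) ∪ F true) := by
    rw [hF.closure_eq_top]; trivial
  induction hw using Subgroup.closure_induction_left with
  | one => exact ⟨1, C.one_mem, true, [], trivial, by simp⟩
  | mul_left x hx y _ ih => exact hx.elim (fun h => step _ x h y ih) (fun h => step _ x h y ih)
  | inv_mul_cancel x hx y _ ih =>
    exact hx.elim (fun h => step _ _ ((F _).inv_mem h) y ih)
      (fun h => step _ _ ((F _).inv_mem h) y ih)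

/-- Whether the last and the first letter cancel does not depend on the normal form. -/
theorem Alt.last_mul_head_mem (hF : IsAmalgam F C) {i k : Bool} {l : List G} {m : List G}
    (hl : Alt F C i l) (hm : Alt F C k m) (h : l.prod = m.prod) {g g' u u' : G}
    (hg : g ∈ l.getLast?) (hg' : g' ∈ l.head?) (hu : u ∈ m.getLast?) (hu' : u' ∈ m.head?)
    (hmem : u * u' ∈ C) : g * g' ∈ C := by
  obtain ⟨hlen, hp⟩ := hl.prefix_mem hF hm C.one_mem (by simpa using h)
  obtain ⟨l₁, rfl⟩ := List.mem_getLast?_eq_getLast hg |>.elim fun hne e =>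
    (⟨l.dropLast, by rw [e, List.dropLast_append_getLast]⟩ : ∃ l₁, l = l₁ ++ [g])
  obtain ⟨m₁, rfl⟩ := List.mem_getLast?_eq_getLast hu |>.elim fun hne e =>
    (⟨m.dropLast, by rw [e, List.dropLast_append_getLast]⟩ : ∃ m₁, m = m₁ ++ [u])
  have hlen' : l₁.length = m₁.length := by simpa using hlen
  have h1 : g'⁻¹ * u' ∈ C := by
    have := hp 1
    rw [List.take_one, List.take_one, Option.mem_def.1 hg', Option.mem_def.1 hu'] at this
    simpa using this
  have h2 : l₁.prod⁻¹ * m₁.prod ∈ C := by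
    have := hp l₁.length
    rw [List.take_left, hlen', List.take_left] at this
    simpa using this
  have h3 : g = l₁.prod⁻¹ * m₁.prod * u := by
    simp only [List.prod_append, List.prod_singleton] at h
    rw [eq_inv_mul_of_mul_eq h, mul_assoc]
  have : g * g' = l₁.prod⁻¹ * m₁.prod * (u * u') * (g'⁻¹ * u')⁻¹ := by
    rw [h3]; group
  rw [this]
  exact C.mul_mem (C.mul_mem h2 hmem) (C.inv_mem h1)

/-! ### Periodic alternating sequences and the conjugates of their periods -/

/-- The list of `n` consecutive terms of a sequence, from the `i`-th on. -/
def seg {α : Type u} (s : ℤ → α) : ℤ → ℕ → List α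
  | _, 0 => []
  | i, n + 1 => s i :: seg s (i + 1) n

theorem length_seg {α : Type u} (s : ℤ → α) (i : ℤ) (n : ℕ) : (seg s i n).length = n := by
  induction n generalizing i with
  | zero => rfl
  | succ n ih => simp [seg, ih]

theorem seg_add {α : Type u} (s : ℤ → α) (i : ℤ) (m n : ℕ) :
    seg s i (m + n) = seg s i m ++ seg s (i + m) n := by
  induction m generalizing i with
  | zero => simp [seg]
  | succ m ih =>
    rw [Nat.add_right_comm, seg, seg, ih, List.cons_append]
    congr 3; push_cast; ring

theorem seg_succ_right {α : Type u} (s : ℤ → α) (i : ℤ) (n : ℕ) :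
    seg s i (n + 1) = seg s i n ++ [s (i + n)] := by
  rw [seg_add]; rfl

theorem take_seg {α : Type u} (s : ℤ → α) (i : ℤ) {m n : ℕ} (h : m ≤ n) :
    (seg s i n).take m = seg s i m := by
  obtain ⟨k, rfl⟩ := Nat.exists_eq_add_of_le h
  rw [seg_add, List.take_left' (length_seg ..)]

theorem seg_congr {α : Type u} {s : ℤ → α} {N : ℤ} (hs : Function.Periodic s N) (i : ℤ) (n : ℕ) :
    seg s (i + N) n = seg s i n := by
  induction n generalizing i with
  | zero => rfl
  | succ n ih => rw [seg, seg, hs, add_right_comm, ih]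

/-- The factor that the `q`-th letter of an alternating sequence lies in. -/
def side (q : ℤ) : Bool := decide (q % 2 = 1)

theorem side_succ (q : ℤ) : side (q + 1) = !side q := by
  unfold side
  rcases Int.emod_two_eq_zero_or_one q with h | h <;> simp [h] <;> omega

theorem side_pred (q : ℤ) : side (q - 1) = !side q := by
  have := side_succ (q - 1)
  rw [sub_add_cancel] at this
  simp [this]

theorem side_add_even (q : ℤ) {n : ℤ} (hn : Even n) : side (q + n) = side q := by
  obtain ⟨m, rfl⟩ := hn
  unfold side; congr 1; simp; omega

/-- A sequence whose terms alternate between the two factors and avoid `C`. -/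
def AltSeq (F : Bool → Subgroup G) (C : Subgroup G) (s : ℤ → G) : Prop :=
  ∀ q, s q ∈ F (side q) ∧ s q ∉ C

theorem AltSeq.alt_seg_append {s : ℤ → G} (hs : AltSeq F C s) (i : ℤ) (n : ℕ) {m : List G}
    (hm : Alt F C (side (i + n)) m) : Alt F C (side i) (seg s i n ++ m) := by
  induction n generalizing i with
  | zero => simpa [seg] using hm
  | succ n ih =>
    refine ⟨(hs i).1, (hs i).2, ?_⟩
    rw [← side_succ]
    refine ih _ ?_
    convert hm using 2; push_cast; ring

theorem AltSeq.alt_seg {s : ℤ → G} (hs : AltSeq F C s) (i : ℤ) (n : ℕ) :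
    Alt F C (side i) (seg s i n) := by
  simpa using hs.alt_seg_append i n (m := []) trivial

theorem conj_prod_seg {s : ℤ → G} {n : ℕ} (hs : Function.Periodic s (n : ℤ)) (i : ℤ) :
    (seg s i n).prod * s i = s i * (seg s (i + 1) n).prod := by
  have h1 := seg_succ_right s i n
  rw [seg, hs] at h1
  simpa using congrArg List.prod h1.symm

/-- A normal form with letters `l` is weakly cyclically reduced. -/
def CycRed (C : Subgroup G) (l : List G) : Prop :=
  l.length ≤ 1 ∨ ∀ g ∈ l.getLast?, ∀ g' ∈ l.head?, g * g' ∉ C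

/-- The shape of a weakly cyclically reduced conjugate `w` of a period of `s`: it is conjugate to
the period that starts at `i` by an element of the factor of `s i`. -/
def IsShift (F : Bool → Subgroup G) (C : Subgroup G) (s : ℤ → G) (n : ℕ) (w : G) (i : ℤ)
    (b : G) : Prop :=
  w = b * (seg s i n).prod * b⁻¹ ∧ b ∈ F (side i) ∧ b * s i ∉ C

theorem IsShift.exists_normalForm (hF : IsAmalgam F C) {s : ℤ → G} (hs : AltSeq F C s) {n : ℕ}
    (hn : Even n) (h2 : 2 ≤ n) {w : G} {i : ℤ} {b : G} (h : IsShift F C s n w i b) :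
    ∃ t, Alt F C (side i) (b * s i :: (seg s (i + 1) (n - 2) ++ t)) ∧
      (b * s i :: (seg s (i + 1) (n - 2) ++ t)).prod = w ∧ (t.length = 1 ∨ t.length = 2) := by
  obtain ⟨rfl, hb, hbs⟩ := h
  obtain ⟨n, rfl⟩ := Nat.exists_eq_add_of_le' h2
  have hseg : seg s i (n + 2) = s i :: (seg s (i + 1) n ++ [s (i + 1 + n)]) := by
    rw [seg, seg_succ_right]
  have hside : side (i + 1 + n) = !side i := by
    rw [add_assoc, add_comm (1 : ℤ), ← add_assoc, side_succ, side_add_even]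
    have : Even n := by simpa [Nat.even_add] using hn
    exact_mod_cast this
  have hbs' := (F (side i)).mul_mem hb (hs i).1
  have hs' := hs (i + 1 + n)
  -- As `n` is even, the last letter of the period lies in the factor opposite to that of `b`. So
  -- `b⁻¹` is absorbed by it if `b ∈ C` and is a separate letter otherwise.
  by_cases hbC : b ∈ C
  · refine ⟨[s (i + 1 + n) * b⁻¹], ⟨hbs', hbs, ?_⟩, ?_, Or.inl rfl⟩
    · rw [← side_succ]
      refine hs.alt_seg_append _ _ ⟨(F _).mul_mem hs'.1 ((F _).inv_mem (hF.le _ hbC)), ?_, trivial⟩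
      rw [C.mul_mem_cancel_right (C.inv_mem hbC)]
      exact hs'.2
    · simp [hseg, mul_assoc]
  · refine ⟨[s (i + 1 + n), b⁻¹], ⟨hbs', hbs, ?_⟩, ?_, Or.inr rfl⟩
    · rw [← side_succ]
      refine hs.alt_seg_append _ _ ⟨hs'.1, hs'.2, ?_, ?_, trivial⟩
      · rw [Nat.add_sub_cancel, hside]; simpa using hb
      · simpa using hbC
    · simp [hseg, mul_assoc]

/-- Induction on the length of the conjugator. Its first letter lies in the factor of `s i` or of `s
(i - 1)`. If it cancels against that letter modulo `C`, the period rotates by one place and the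
conjugator gets shorter. If it does not cancel and the conjugator has further letters, the conjugate
begins with `v⁻¹` and ends with `v`, against weak cyclic reducedness; so a single letter remains. -/
theorem exists_isShift (hF : IsAmalgam F C) {s : ℤ → G} (hs : AltSeq F C s) {n : ℕ}
    (hn : Even n) (h2 : 2 ≤ n) (hper : Function.Periodic s (n : ℤ)) {w : G}
    (hcyc : ∀ k m, Alt F C k m → m.prod = w → CycRed C m)
    {i₀ : ℤ} (hconj : IsConj (seg s i₀ n).prod w) : ∃ i b, IsShift F C s n w i b := by
  have hsid : ∀ i, side (i + n) = side i := fun i => side_add_even i (by exact_mod_cast hn)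
  have hleft : ∀ i b, w = b * (seg s i n).prod * b⁻¹ → b ∈ C → ∃ i b, IsShift F C s n w i b :=
    fun i b h hb => ⟨i, b, h, hF.le _ hb, fun h' => (hs i).2 ((C.mul_mem_cancel_left hb).1 h')⟩
  have nocancel : ∀ i k u (l : List G), Alt F C k (u :: l) → k = side i → u⁻¹ * s i ∉ C →
      w = (u :: l).prod⁻¹ * (seg s i n).prod * (u :: l).prod → ∃ i b, IsShift F C s n w i b := by
    rintro i k u l hl rfl hu h
    rcases List.eq_nil_or_concat' l with rfl | ⟨l', v, rfl⟩
    · exact ⟨i, u⁻¹, by simpa using h, by simpa using hl.1, hu⟩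
    exfalso
    obtain ⟨n, rfl⟩ := Nat.exists_eq_add_of_le' (one_le_two.trans h2)
    have h1 : Alt F C (side i) (u⁻¹ * s i :: (seg s (i + 1) n ++ (u :: l' ++ [v]))) := by
      refine ⟨(F _).mul_mem ((F _).inv_mem hl.1) (hs i).1, hu, ?_⟩
      rw [← side_succ]
      refine hs.alt_seg_append _ _ ?_
      rw [show i + 1 + (n : ℤ) = i + ((n + 1 : ℕ) : ℤ) by push_cast; ring, hsid]
      simpa using hl
    obtain ⟨k, hk⟩ := hl.2.2.inv_reverse_append (by simpa using h1)
    have hpr : (((l' ++ [v]).map (·⁻¹)).reverse ++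
        u⁻¹ * s i :: (seg s (i + 1) n ++ (u :: l' ++ [v]))).prod = w := by
      rw [List.prod_append, prod_inv_reverse, h]
      simp [seg, mul_assoc]
    rcases hcyc _ _ hk hpr with hc | hc
    · simp at hc
    · refine hc v ?_ v⁻¹ ?_ (by simp [C.one_mem])
      · simp [List.getLast?_cons, List.getLast?_append]
      · simp
  have main : ∀ m (l : List G), l.length = m → ∀ k, Alt F C k l → ∀ c ∈ C, ∀ i,
      w = (c * l.prod)⁻¹ * (seg s i n).prod * (c * l.prod) → ∃ i b, IsShift F C s n w i b := by
    intro m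
    induction m with
    | zero =>
      intro l hl k _ c hc i h
      obtain rfl := List.eq_nil_of_length_eq_zero hl
      exact hleft i c⁻¹ (by simpa using h) (C.inv_mem hc)
    | succ m ih =>
      intro l hlen k hl c hc i h
      obtain ⟨u, l, rfl⟩ := List.exists_cons_of_length_eq_add_one hlen
      replace hl := hl.mul_head hF hc
      have h' : w = (c * u :: l).prod⁻¹ * (seg s i n).prod * (c * u :: l).prod := by
        simpa [mul_assoc] using h
      generalize c * u = u at hl h'
      have hm : l.length = m := by simpa using hlen
      by_cases hk : k = side i
      · by_cases hu : u⁻¹ * s i ∈ C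
        · refine ih l hm _ hl.2.2 (u⁻¹ * s i)⁻¹ (C.inv_mem hu) (i + 1) ?_
          have e : (seg s i n).prod = s i * (seg s (i + 1) n).prod * (s i)⁻¹ := by
            rw [← conj_prod_seg hper]; group
          rw [h', e, List.prod_cons]; group
        · exact nocancel i k u l hl hk hu h'
      · have e : (seg s i n).prod = (s (i - 1))⁻¹ * (seg s (i - 1) n).prod * s (i - 1) := by
          have := conj_prod_seg hper (i - 1)
          rw [sub_add_cancel] at this
          rw [mul_assoc, this]; group
        have hk' : k = side (i - 1) := by
          rw [side_pred]; revert hk; cases k <;> cases side i <;> simp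
        by_cases hu : s (i - 1) * u ∈ C
        · refine ih l hm _ hl.2.2 (s (i - 1) * u) hu (i - 1) ?_
          rw [h', e, List.prod_cons]; group
        · refine nocancel (i - 1) k (s (i - 1) * u) l ⟨?_, hu, hl.2.2⟩ hk' ?_ ?_
          · rw [hk']; exact (F _).mul_mem (hs _).1 (hk' ▸ hl.1)
          · simpa using hl.2.1
          · rw [h', e, List.prod_cons, List.prod_cons]; group
  obtain ⟨z, hz⟩ := isConj_iff.1 hconj
  obtain ⟨c, hc, k, l, hl, hcl⟩ := hF.exists_alt z⁻¹
  exact main _ l rfl k hl c hc i₀ (by rw [← hcl, ← hz]; group)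

theorem prod_seg_inv (s : ℤ → G) (i : ℤ) (n : ℕ) :
    (seg s i n).prod⁻¹ = (seg (fun q => (s (-q))⁻¹) (1 - i - n) n).prod := by
  induction n generalizing i with
  | zero => simp [seg]
  | succ n ih =>
    rw [seg_succ_right _ (1 - i - _), List.prod_append, seg, List.prod_cons, mul_inv_rev, ih,
      List.prod_singleton]
    congr 3
    · push_cast; ring_nf
    · push_cast; ring

theorem IsShift.eq_conj {s : ℤ → G} {n : ℕ} (hper : Function.Periodic s (n : ℤ)) {w : G} {i : ℤ}
    {b : G} (h : IsShift F C s n w i b) (j : ℕ) :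
    w = b * (seg s i j).prod * (seg s (i + j) n).prod * (b * (seg s i j).prod)⁻¹ := by
  have : (seg s i n).prod * (seg s i j).prod = (seg s i j).prod * (seg s (i + j) n).prod := by
    rw [← List.prod_append, ← List.prod_append, ← seg_add, add_comm j n, seg_add s i n j,
      seg_congr hper]
  rw [h.1, mul_assoc b (seg s i j).prod, ← this]
  group

/-- The bounds on `j` keep away from both ends: the first letter has to be included because it has
absorbed `b`, and the last letter of the period is left out because it may have absorbed `b⁻¹`. -/
theorem IsShift.prefix_mem (hF : IsAmalgam F C) {s : ℤ → G} (hs : AltSeq F C s) {n : ℕ}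
    (hn : Even n) (h2 : 2 ≤ n) {w : G} {i : ℤ} {b : G} (h : IsShift F C s n w i b)
    {m : List G} {k : Bool} (hm : Alt F C k m) (hw : m.prod = w) {j : ℕ} (h1 : 1 ≤ j)
    (hj : j < n) : (m.take j).prod⁻¹ * (b * (seg s i j).prod) ∈ C := by
  obtain ⟨t, ht, hp, -⟩ := h.exists_normalForm hF hs hn h2
  have := (hm.prefix_mem hF ht C.one_mem (by rw [one_mul, hw, hp])).2 j
  obtain ⟨j, rfl⟩ := Nat.exists_eq_add_of_le' h1
  rw [List.take_succ_cons, List.take_append_of_le_length (by rw [length_seg]; omega),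
    take_seg _ _ (by omega)] at this
  simpa [seg, mul_assoc] using this

end Abstract

/-! ### The amalgamated product as an abstract amalgam -/

section Bridge

variable {K L : Type u} [Group K] [Group L] {H : Subgroup K} {H' : Subgroup L} (φ : H ≃* H')

theorem incl_injective (i : Bool) : Function.Injective (incl φ i) := by
  cases i
  · exact H.subtype_injective
  · exact H'.subtype_injective.comp φ.injective

/-- The copies of `K` and `L` in the amalgamated product. -/
def factor (i : Bool) : Subgroup (AmalgamatedProduct φ) :=
  (Monoid.PushoutI.of (φ := incl φ) i).range

theorem base_eq_range : base φ = (Monoid.PushoutI.base (incl φ)).range := by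
  rw [base, ← Monoid.PushoutI.of_comp_eq_base (φ := incl φ) false, MonoidHom.range_comp]
  congr 1
  exact H.range_subtype.symm

theorem exists_word (i : Bool) (l : List (AmalgamatedProduct φ))
    (hl : Alt (factor φ) (base φ) i l) :
    ∃ t : List (Σ i, Factor K L i), t.map (fun p => Monoid.PushoutI.of (φ := incl φ) p.1 p.2) = l ∧
      t.IsChain (fun p q => p.1 ≠ q.1) ∧
      (∀ p ∈ t, Monoid.PushoutI.of (φ := incl φ) p.1 p.2 ∉ base φ) ∧ ∀ p ∈ t.head?, p.1 = i := by
  induction l generalizing i with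
  | nil => exact ⟨[], by simp⟩
  | cons g l ih =>
    obtain ⟨t, rfl, hc, hb, hh⟩ := ih _ hl.2.2
    obtain ⟨g, rfl⟩ := hl.1
    refine ⟨⟨i, g⟩ :: t, rfl, ?_, ?_, by simp⟩
    · rw [List.isChain_cons]
      refine ⟨fun p hp => ?_, hc⟩
      rw [hh p hp]; simp
    · simpa using ⟨hl.2.1, hb⟩

theorem isAmalgam : IsAmalgam (factor φ) (base φ) where
  le i := by
    rw [base_eq_range, ← Monoid.PushoutI.of_comp_eq_base (φ := incl φ) i]
    rintro _ ⟨c, rfl⟩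
    exact ⟨incl φ i c, rfl⟩
  mem_of_mem g i h1 h2 := by
    rw [base_eq_range, ← Monoid.PushoutI.inf_of_range_eq_base_range (incl_injective φ)
      (show i ≠ !i by simp)]
    exact ⟨h1, h2⟩
  eq_nil i l hl h := by
    obtain ⟨t, rfl, hc, hb, -⟩ := exists_word φ i l hl
    have hb' : ∀ p ∈ t, p.2 ∉ (incl φ p.1).range := by
      rintro p hp ⟨c, hc⟩
      refine hb p hp ?_
      rw [← hc, Monoid.PushoutI.of_apply_eq_base, base_eq_range]
      exact ⟨c, rfl⟩
    have := Monoid.PushoutI.Reduced.eq_empty_of_mem_range (incl_injective φ)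
      (w := ⟨t, fun p hp h1 => hb' p hp (h1 ▸ one_mem _), hc⟩) hb' (by
        rw [← base_eq_range]
        convert h
        simp only [Monoid.CoprodI.Word.prod, map_list_prod, List.map_map]
        congr 1)
    have ht : t = [] := congrArg Monoid.CoprodI.Word.toList this
    simp [ht]
  closure_eq_top := by
    rw [eq_top_iff]
    rintro w -
    induction w using Monoid.PushoutI.induction_on with
    | of i g =>
      refine Subgroup.subset_closure ?_
      cases i
      · exact Or.inl ⟨g, rfl⟩
      · exact Or.inr ⟨g, rfl⟩
    | base c =>
      rw [← Monoid.PushoutI.of_apply_eq_base _ false]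
      exact Subgroup.subset_closure (Or.inl ⟨_, rfl⟩)
    | mul v w hv hw => exact mul_mem hv hw

variable {φ}

theorem alt_of_isChain (l : List (AmalgamatedProduct φ)) (g : AmalgamatedProduct φ)
    (hc : (g :: l).IsChain fun g g' =>
      (g ∈ left φ ∧ g' ∈ right φ) ∨ (g ∈ right φ ∧ g' ∈ left φ))
    (hb : ∀ u ∈ g :: l, u ∉ base φ) (i : Bool) (hi : g ∈ factor φ i) :
    Alt (factor φ) (base φ) i (g :: l) := by
  induction l generalizing g i with
  | nil => exact ⟨hi, by simpa using hb, trivial⟩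
  | cons g' l ih =>
    rw [List.isChain_cons_cons] at hc
    have hg := hb g (by simp)
    refine ⟨hi, hg, ih g' hc.2 (fun u hu => hb u (by simp [hu])) _ ?_⟩
    rcases hc.1 with ⟨h1, h2⟩ | ⟨h1, h2⟩ <;> cases i
    · exact h2
    · exact absurd ((isAmalgam φ).mem_of_mem g true hi h1) hg
    · exact absurd ((isAmalgam φ).mem_of_mem g false hi h1) hg
    · exact h2

theorem IsNormalForm.alt {l : List (AmalgamatedProduct φ)} {w : AmalgamatedProduct φ}
    (h : IsNormalForm l w) :
    (∃ i, Alt (factor φ) (base φ) i l) ∨ ∃ c ∈ base φ, c ≠ 1 ∧ l = [c] := by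
  rcases l with _ | ⟨g, l⟩
  · exact Or.inl ⟨true, trivial⟩
  obtain ⟨i, hi⟩ : ∃ i, g ∈ factor φ i :=
    (h.letter g (by simp)).elim (fun h => ⟨false, h⟩) fun h => ⟨true, h⟩
  rcases l with _ | ⟨g', l⟩
  · by_cases hg : g ∈ base φ
    · exact Or.inr ⟨g, hg, fun h1 => h.ne_one (by rw [h1]), rfl⟩
    · exact Or.inl ⟨i, hi, hg, trivial⟩
  · exact Or.inl ⟨i, alt_of_isChain _ g h.alternating (h.notMem_base (by simp)) i hi⟩

theorem Alt.isChain_and {l : List (AmalgamatedProduct φ)} {i : Bool}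
    (h : Alt (factor φ) (base φ) i l) :
    (l.IsChain fun g g' => (g ∈ left φ ∧ g' ∈ right φ) ∨ (g ∈ right φ ∧ g' ∈ left φ)) ∧
      ∀ g ∈ l, (g ∈ left φ ∨ g ∈ right φ) ∧ g ∉ base φ := by
  induction l generalizing i with
  | nil => simp
  | cons g l ih =>
    obtain ⟨h1, h2⟩ := ih h.2.2
    refine ⟨?_, ?_⟩
    · rcases l with _ | ⟨g', l⟩
      · simp
      · rw [List.isChain_cons_cons]
        refine ⟨?_, h1⟩
        cases i
        · exact Or.inl ⟨h.1, h.2.2.1⟩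
        · exact Or.inr ⟨h.1, h.2.2.1⟩
    · rintro u hu
      rcases List.mem_cons.1 hu with rfl | hu
      · refine ⟨?_, h.2.1⟩
        cases i
        · exact Or.inl h.1
        · exact Or.inr h.1
      · exact h2 u hu

theorem Alt.isNormalForm {l : List (AmalgamatedProduct φ)} {w : AmalgamatedProduct φ} {i : Bool}
    (h : Alt (factor φ) (base φ) i l) (hw : l.prod = w) : IsNormalForm l w where
  prod_eq := hw
  letter g hg := (h.isChain_and.2 g hg).1
  alternating := h.isChain_and.1
  notMem_base _ g hg := (h.isChain_and.2 g hg).2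
  ne_one h1 := (h.isChain_and.2 1 (by simp [h1])).2 (one_mem _)

theorem IsNormalForm.length_eq_of_alt {l m : List (AmalgamatedProduct φ)}
    {w : AmalgamatedProduct φ} {i : Bool} (h : IsNormalForm l w)
    (hm : Alt (factor φ) (base φ) i m) (hw : m.prod = w) : l.length = m.length := by
  rcases h.alt with ⟨k, hl⟩ | ⟨c, hc, hc1, rfl⟩
  · exact (hl.prefix_mem (isAmalgam φ) hm (one_mem _) (by simp [hw, h.prod_eq])).1
  · have h1 := h.prod_eq
    rw [List.prod_singleton] at h1
    have := (isAmalgam φ).eq_nil i m hm (by rwa [hw, ← h1])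
    rw [this, List.prod_nil, ← h1] at hw
    exact absurd hw.symm hc1

theorem IsNormalForm.length_unique {l m : List (AmalgamatedProduct φ)}
    {w : AmalgamatedProduct φ} (h : IsNormalForm l w) (h' : IsNormalForm m w) :
    l.length = m.length := by
  rcases h'.alt with ⟨k, hm⟩ | ⟨c, hc, hc1, rfl⟩
  · exact h.length_eq_of_alt hm h'.prod_eq
  · rcases h.alt with ⟨k, hl⟩ | ⟨c, hc, hc1, rfl⟩
    · exact (h'.length_eq_of_alt hl h.prod_eq).symm
    · rfl

theorem IsNormalForm.length_eq {l : List (AmalgamatedProduct φ)}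
    {w : AmalgamatedProduct φ} (h : IsNormalForm l w) : length w = l.length := by
  have : {n | ∃ l, IsNormalForm l w ∧ l.length = n} = {l.length} := by
    ext n
    refine ⟨?_, ?_⟩
    · rintro ⟨m, hm, rfl⟩
      exact hm.length_unique h
    · rintro rfl
      exact ⟨l, h, rfl⟩
  rw [length, this, csInf_singleton]

theorem IsWeaklyCyclicallyReduced.cycRed {w : AmalgamatedProduct φ}
    (h : IsWeaklyCyclicallyReduced w) (i : Bool) (m : List (AmalgamatedProduct φ))
    (hm : Alt (factor φ) (base φ) i m) (hw : m.prod = w) : CycRed (base φ) m := by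
  obtain ⟨l, hl, hc⟩ := h
  have hlen := hl.length_eq_of_alt hm hw
  rcases hc with hc | hc
  · exact Or.inl (hlen ▸ hc)
  rcases hl.alt with ⟨k, hl'⟩ | ⟨c, -, -, rfl⟩
  · refine or_iff_not_imp_left.2 fun hlt u hu u' hu' hmem => ?_
    have hne : l ≠ [] := by rintro rfl; simp at hlen; omega
    exact hc _ (List.getLast_mem_getLast? hne) _ (List.head_mem_head? hne)
      (hl'.last_mul_head_mem (isAmalgam φ) hm (hl.prod_eq.trans hw.symm)
        (List.getLast_mem_getLast? hne) (List.head_mem_head? hne) hu hu' hmem)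
  · exact Or.inl (hlen ▸ le_rfl)

/-- In a semireduced product, all letters of the left factor but the last are unchanged. -/
theorem IsSemireduced.exists_alt {b c : AmalgamatedProduct φ} (h : IsSemireduced b c)
    {u : List (AmalgamatedProduct φ)} (hu : IsNormalForm u b) (h2 : 2 ≤ u.length) :
    ∃ k m, Alt (factor φ) (base φ) k m ∧ m.prod = b * c ∧
      ∀ j < u.length, m.take j = u.take j := by
  have hF := isAmalgam φ
  rcases hu.alt with ⟨i, hu'⟩ | ⟨_, -, -, rfl⟩
  swap
  · simp at h2
  rcases List.eq_nil_or_concat' u with rfl | ⟨u₀, g, rfl⟩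
  · simp at h2
  have hb := hu.prod_eq
  rw [List.prod_append, List.prod_singleton] at hb
  obtain ⟨k, hgk, hg, happ⟩ := hu'.append_of_last
  have htake : ∀ m : List (AmalgamatedProduct φ), ∀ j < (u₀ ++ [g]).length,
      (u₀ ++ m).take j = (u₀ ++ [g]).take j := by
    intro m j hj
    have hj' : j ≤ u₀.length := by simpa [Nat.lt_succ_iff] using hj
    rw [List.take_append_of_le_length hj', List.take_append_of_le_length hj']
  -- The last letter `g` of `b` absorbs an element of `H`, merges with the first letter of `c`, or
  -- stays as it is; semireducedness keeps a merged letter outside `H`.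
  obtain ⟨d, hd, k', l, hl, rfl⟩ := hF.exists_alt c
  rcases l with _ | ⟨g', l⟩
  · refine ⟨i, u₀ ++ [g * d], happ _ ⟨mul_mem hgk (hF.le k hd), ?_, trivial⟩, ?_, htake _⟩
    · rwa [Subgroup.mul_mem_cancel_right _ hd]
    · simp [← hb, mul_assoc]
  · replace hl := hl.mul_head hF hd
    have hprod : (d * g' :: l).prod = d * (g' :: l).prod := by simp [mul_assoc]
    rw [← hprod] at h ⊢
    generalize d * g' = g' at h hl
    by_cases hk : k' = k
    · subst hk
      refine ⟨i, u₀ ++ g * g' :: l, happ _ ⟨mul_mem hgk hl.1, ?_, hl.2.2⟩, ?_, htake _⟩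
      · exact h _ _ hu (hl.isNormalForm rfl) g (by simp) g' (by simp)
      · simp [← hb, mul_assoc]
    · have hk' : k' = !k := by revert hk; cases k <;> cases k' <;> simp
      subst hk'
      refine ⟨i, u₀ ++ g :: g' :: l, happ _ ⟨hgk, hg, hl⟩, ?_, htake _⟩
      simp [← hb, mul_assoc]

/-- The weakly cyclically reduced conjugates of `r` and `r⁻¹` already form a symmetrized set. If `r`
were not weakly cyclically reduced, no symmetrized set would contain it and the intersection would
be the whole group. -/
theorem isSymmetrized_symmetrizedClosure {r : AmalgamatedProduct φ}
    (hr : IsWeaklyCyclicallyReduced r) :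
    IsSymmetrized (symmetrizedClosure r) ∧ ∀ w ∈ symmetrizedClosure r,
      IsWeaklyCyclicallyReduced w ∧ (IsConj r w ∨ IsConj r⁻¹ w) := by
  have hinv : ∀ {a b : AmalgamatedProduct φ}, IsConj a b → IsConj a⁻¹ b⁻¹ := by
    intro a b hab
    obtain ⟨c, hc⟩ := isConj_iff.1 hab
    exact isConj_iff.2 ⟨c, by rw [← hc]; group⟩
  let S : Set (AmalgamatedProduct φ) :=
    {w | IsWeaklyCyclicallyReduced w ∧ (IsConj r w ∨ IsConj r⁻¹ w)}
  have hS : IsSymmetrized S := by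
    rintro v ⟨hv, hrv⟩
    refine ⟨hv, fun w hw h => ⟨hw, ?_⟩⟩
    rcases hrv with hrv | hrv <;> rcases h with h | h
    · exact Or.inl (hrv.trans h)
    · exact Or.inr ((hinv hrv).trans h)
    · exact Or.inr (hrv.trans h)
    · exact Or.inl ((by simpa using hinv hrv : IsConj r v⁻¹).trans h)
  have hsub : ∀ w ∈ symmetrizedClosure r, w ∈ S :=
    fun w hw => hw S ⟨hS, hr, Or.inl (IsConj.refl r)⟩
  exact ⟨fun w hw => ⟨(hsub w hw).1, fun v hv h T hT => (hT.1 w (hw T hT)).2 v hv h⟩, hsub⟩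

end Bridge

/-! ### Block structure of the letters from `K` -/

section Blocks

/-- The position, among the letters from `K`, at which the `k`-th block of the relator starts. -/
def blk : ℕ → ℤ
  -- Block `k` has `k + 1` letters, so this value puts block 1, which is `h y`, at position 0, and
  -- block 81 at the period 3320.
  | 0 => -1
  | k + 1 => blk k + (k + 1)

theorem two_mul_blk (k : ℕ) : 2 * blk k + 2 = k * (k + 1) := by
  induction k with
  | zero => rfl
  | succ k ih => rw [blk]; push_cast; linarith

theorem blk_strictMono : StrictMono blk :=
  strictMono_nat_of_lt_succ fun k => by rw [blk]; omega

theorem blk_eq (n : ℤ) {k : ℕ} (h : (k : ℤ) * (k + 1) = 2 * n + 2) : blk k = n := by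
  linarith [two_mul_blk k]

theorem exists_blk_add (n : ℕ) (r : ℤ) (h0 : 0 ≤ r) (hr : r < blk (n + 1)) :
    ∃ k t : ℕ, 1 ≤ k ∧ k ≤ n ∧ t ≤ k ∧ r = blk k + t := by
  induction n with
  | zero => exact absurd hr (by rw [blk, blk]; simpa using h0)
  | succ n ih =>
    by_cases h : r < blk (n + 1)
    · obtain ⟨k, t, h1, h2, h3⟩ := ih h
      exact ⟨k, t, h1, by omega, h3⟩
    · rw [blk] at hr
      exact ⟨n + 1, (r - blk (n + 1)).toNat, by omega, le_rfl, by omega, by omega⟩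

theorem exists_eq_blk_add (p : ℤ) :
    ∃ (m : ℤ) (k t : ℕ), 1 ≤ k ∧ k ≤ 80 ∧ t ≤ k ∧ p = blk k + t + 3320 * m := by
  have h81 : blk (80 + 1) = 3320 := blk_eq _ (by norm_num)
  obtain ⟨k, t, h1, h2, h3, h4⟩ := exists_blk_add 80 (p % 3320) (by omega) (by omega)
  exact ⟨p / 3320, k, t, h1, h2, h3, by omega⟩

variable {K : Type u} (x y h : K)

open Classical in
/-- The letters of the relator that come from `K`, continued periodically. -/
noncomputable def leftLetter (p : ℤ) : K :=
  if p % 3320 = 0 then h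
  else if ∃ k : ℕ, 2 ≤ k ∧ k ≤ 80 ∧ p % 3320 = blk k then x else y

theorem blk_bounds {k : ℕ} (h1 : 1 ≤ k) (h2 : k ≤ 80) : 0 ≤ blk k ∧ blk k + k < 3320 := by
  have h3 := blk_strictMono.monotone h1
  have h4 := blk_strictMono.monotone (Nat.succ_le_succ h2)
  have h81 : blk (80 + 1) = 3320 := blk_eq _ (by norm_num)
  have h11 : blk 1 = 0 := blk_eq _ (by norm_num)
  have h5 : blk (k + 1) = blk k + (k + 1) := rfl
  rw [Nat.succ_eq_add_one, Nat.succ_eq_add_one] at h4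
  omega

theorem leftLetter_periodic : Function.Periodic (leftLetter x y h) 3320 := by
  intro p
  rw [leftLetter, leftLetter, Int.add_emod_right]

theorem leftLetter_zero : leftLetter x y h 0 = h := by simp [leftLetter]

theorem leftLetter_blk (m : ℤ) {k : ℕ} (h1 : 2 ≤ k) (h2 : k ≤ 80) :
    leftLetter x y h (blk k + 3320 * m) = x := by
  have hb := blk_bounds (by omega) h2
  have h3 := blk_strictMono h1
  have h11 : blk 1 = 0 := blk_eq _ (by norm_num)
  have hm : (blk k + 3320 * m) % 3320 = blk k := by omega
  rw [leftLetter, hm, if_neg (by omega), if_pos ⟨k, h1, h2, rfl⟩]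

theorem leftLetter_blk_add (m : ℤ) {k t : ℕ} (h1 : 1 ≤ k) (h2 : k ≤ 80) (ht : 1 ≤ t)
    (htk : t ≤ k) : leftLetter x y h (blk k + t + 3320 * m) = y := by
  have hb := blk_bounds h1 h2
  have hm : (blk k + t + 3320 * m) % 3320 = blk k + t := by omega
  rw [leftLetter, hm, if_neg (by omega), if_neg]
  rintro ⟨j, -, -, hj⟩
  rcases Nat.lt_or_ge k j with hkj | hkj
  · have h3 := blk_strictMono.monotone (Nat.succ_le_of_lt hkj)
    have h5 : blk (k + 1) = blk k + (k + 1) := rfl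
    simp only [Nat.succ_eq_add_one] at h3
    omega
  · have h3 := blk_strictMono.monotone hkj
    omega

theorem leftLetter_cases (p : ℤ) :
    leftLetter x y h p = h ∨ leftLetter x y h p = x ∨ leftLetter x y h p = y := by
  unfold leftLetter
  split_ifs <;> simp

/-- Every stretch of 300 letters contains two complete consecutive blocks. -/
theorem exists_blocks_mem_window (p : ℤ) : ∃ (m : ℤ) (k : ℕ), 2 ≤ k ∧ k ≤ 78 ∧
    p ≤ blk k + 3320 * m ∧ blk (k + 2) + 3320 * m < p + 300 := by
  obtain ⟨m, j, t, h1, h2, h3, rfl⟩ := exists_eq_blk_add p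
  -- Blocks `j + 1` and `j + 2` end within `3 * j + 6 ≤ 237` places of the start of block `j`. From
  -- block 78 on, blocks 2 and 3 of the next period serve, at most 3320 + 9 - 3080 = 249 places
  -- away. Block 1 is avoided because it starts with `h`.
  by_cases hj : j ≤ 77
  · refine ⟨m, j + 1, by omega, by omega, ?_, ?_⟩
    · rw [blk]; omega
    · rw [blk, blk, blk]; push_cast; omega
  · have h4 : blk (2 + 2) = 9 := blk_eq _ (by norm_num)
    have h22 : blk 2 = 2 := blk_eq _ (by norm_num)
    have h78 : blk 78 = 3080 := blk_eq _ (by norm_num)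
    have := blk_strictMono.monotone (show 78 ≤ j by omega)
    have := blk_bounds h1 h2
    refine ⟨m + 1, 2, le_rfl, by omega, ?_, ?_⟩ <;> omega

variable {x y h} {X Y : K → Prop} (hx : X x) (hy : Y y) (hXY : ∀ g, X g → ¬ Y g)

include hx hy hXY

/-- A complete block, recognized by the classes of its letters, occurs only at its own place. -/
theorem eq_blk_of_pattern {k : ℕ} (h1 : 1 ≤ k) (h2 : k ≤ 80) {q : ℤ}
    (hq : X (leftLetter x y h q)) (hq' : X (leftLetter x y h (q + (k + 1))))
    (hY : ∀ t : ℕ, 1 ≤ t → t ≤ k → Y (leftLetter x y h (q + t))) :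
    ∃ m : ℤ, q = blk k + 3320 * m := by
  obtain ⟨m, j, t, h3, h4, h5, rfl⟩ := exists_eq_blk_add q
  have ht : t = 0 := by
    by_contra ht
    rw [leftLetter_blk_add x y h m h3 h4 (by omega) h5] at hq
    exact hXY y hq hy
  subst ht
  -- If block `j` is longer, the closing `X` falls on one of its `y`s; if it is shorter, the `x`
  -- that opens block `j + 1` falls where a `Y` is required.
  rcases lt_trichotomy k j with hkj | rfl | hkj
  · have := leftLetter_blk_add x y h m h3 h4 (t := k + 1) (by omega) (by omega)
    rw [show blk j + ((0 : ℕ) : ℤ) + 3320 * m + (k + 1) =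
      blk j + ((k + 1 : ℕ) : ℤ) + 3320 * m by push_cast; ring, this] at hq'
    exact absurd hy (hXY y hq')
  · exact ⟨m, by simp⟩
  · have := hY (j + 1) (by omega) (by omega)
    rw [show blk j + ((0 : ℕ) : ℤ) + 3320 * m + ((j + 1 : ℕ) : ℤ) = blk (j + 1) + 3320 * m by
      rw [blk]; push_cast; ring, leftLetter_blk x y h m (by omega) (by omega)] at this
    exact absurd this (hXY x hx)

/-- A single block `x y ⋯ y x` in the window suffices: its translate has the same number of `y`s, so
it is the same block, possibly in another period. -/
theorem dvd_of_window {p d : ℤ} (hX : ∀ q, p ≤ q → q < p + 300 →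
      X (leftLetter x y h q) → X (leftLetter x y h (q + d)))
    (hY : ∀ q, p ≤ q → q < p + 300 → Y (leftLetter x y h q) → Y (leftLetter x y h (q + d))) :
    (3320 : ℤ) ∣ d := by
  obtain ⟨m, k, h1, h2, h3, h4⟩ := exists_blocks_mem_window p
  rw [blk, blk] at h4
  push_cast at h4
  obtain ⟨m', hm'⟩ := eq_blk_of_pattern (h := h) hx hy hXY (k := k) (q := blk k + 3320 * m + d)
    (by omega) (by omega)
    (hX _ h3 (by omega) (by rw [leftLetter_blk x y h m h1 (by omega)]; exact hx))
    (by
      have := hX (blk (k + 1) + 3320 * m) (by rw [blk]; omega) (by rw [blk]; omega)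
        (by rw [leftLetter_blk x y h m (by omega) (by omega)]; exact hx)
      rw [blk] at this
      convert this using 2; ring)
    (fun t ht htk => by
      have := hY (blk k + t + 3320 * m) (by omega) (by omega)
        (by rw [leftLetter_blk_add x y h m (by omega) (by omega) ht htk]; exact hy)
      convert this using 2; ring)
  exact ⟨m' - m, by omega⟩

/-- A block read backwards is again a block with as many `y`s, so reflection would send blocks `k`
and `k + 1` to their own places modulo 3320 while exchanging their order. Comparing the two
resulting values of `d` makes `2 * k + 3` divisible by 3320, which is impossible for an odd number.
-/
theorem not_window_reversed {p d : ℤ} (hX : ∀ q, p ≤ q → q < p + 300 →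
      X (leftLetter x y h q) → X (leftLetter x y h (d - q)))
    (hY : ∀ q, p ≤ q → q < p + 300 → Y (leftLetter x y h q) → Y (leftLetter x y h (d - q))) :
    False := by
  obtain ⟨m, k, h1, h2, h3, h4⟩ := exists_blocks_mem_window p
  have pattern : ∀ j : ℕ, k ≤ j → j ≤ k + 1 →
      ∃ m' : ℤ, d - (blk (j + 1) + 3320 * m) = blk j + 3320 * m' := by
    intro j hj hj'
    have hk := blk_strictMono.monotone hj
    have hk' := blk_strictMono.monotone (show j + 1 ≤ k + 2 by omega)
    have hb : blk (j + 1) = blk j + (j + 1) := rfl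
    refine eq_blk_of_pattern (h := h) hx hy hXY (by omega) (by omega) ?_ ?_ fun t ht htj => ?_
    · exact hX _ (by omega) (by omega)
        (by rw [leftLetter_blk x y h m (by omega) (by omega)]; exact hx)
    · have := hX (blk j + 3320 * m) (by omega) (by omega)
        (by rw [leftLetter_blk x y h m (by omega) (by omega)]; exact hx)
      convert this using 2; omega
    · have := hY (blk j + ((j + 1 - t : ℕ) : ℤ) + 3320 * m) (by omega) (by omega)
        (by rw [leftLetter_blk_add x y h m (by omega) (by omega) (by omega) (by omega)]; exact hy)
      convert this using 2; omega
  obtain ⟨m₁, e₁⟩ := pattern k le_rfl (by omega)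
  obtain ⟨m₂, e₂⟩ := pattern (k + 1) (by omega) le_rfl
  rw [blk, blk] at e₂
  rw [blk] at e₁
  push_cast at e₁ e₂
  omega

end Blocks

/-! ### Double coset types and comparison of two shifts -/

section Pieces

variable {K L : Type u} [Group K] [Group L] {H : Subgroup K} {H' : Subgroup L} (φ : H ≃* H')

theorem ofLeft_injective : Function.Injective (ofLeft φ) :=
  Monoid.PushoutI.of_injective (incl_injective φ) false

theorem ofRight_injective : Function.Injective (ofRight φ) :=
  Monoid.PushoutI.of_injective (incl_injective φ) true

theorem ofLeft_mem_base {g : K} : ofLeft φ g ∈ base φ ↔ g ∈ H :=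
  Subgroup.mem_map_iff_mem (ofLeft_injective φ)

theorem ofRight_mem_base {g : L} : ofRight φ g ∈ base φ ↔ g ∈ H' := by
  have : base φ = H'.map (ofRight φ) := by
    rw [base_eq_range, ← Monoid.PushoutI.of_comp_eq_base (φ := incl φ) true, MonoidHom.range_comp]
    congr 1
    ext g
    refine ⟨?_, fun hg => ⟨φ.symm ⟨g, hg⟩,
      congrArg Subtype.val (φ.apply_symm_apply ⟨g, hg⟩)⟩⟩
    rintro ⟨c, rfl⟩
    exact (φ c).2
  rw [this]
  exact Subgroup.mem_map_iff_mem (ofRight_injective φ)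

/-- The union of the double cosets of `z` and `z⁻¹` in the amalgamated product. -/
def SameType (z : K) (g : AmalgamatedProduct φ) : Prop :=
  ∃ ε : ℤˣ, ∃ c ∈ base φ, ∃ d ∈ base φ, g = c * ofLeft φ (z ^ (ε : ℤ)) * d

variable {φ}

theorem sameType_self (z : K) : SameType φ z (ofLeft φ z) :=
  ⟨1, 1, one_mem _, 1, one_mem _, by simp⟩

theorem SameType.mul_mul {z : K} {g : AmalgamatedProduct φ} (h : SameType φ z g)
    {c d : AmalgamatedProduct φ} (hc : c ∈ base φ) (hd : d ∈ base φ) :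
    SameType φ z (c * g * d) := by
  obtain ⟨ε, c', hc', d', hd', rfl⟩ := h
  exact ⟨ε, c * c', mul_mem hc hc', d' * d, mul_mem hd' hd, by simp only [mul_assoc]⟩

theorem SameType.inv {z : K} {g : AmalgamatedProduct φ} (h : SameType φ z g) :
    SameType φ z g⁻¹ := by
  obtain ⟨ε, c, hc, d, hd, rfl⟩ := h
  exact ⟨-ε, d⁻¹, inv_mem hd, c⁻¹, inv_mem hc, by simp [mul_assoc]⟩

theorem sameType_inv_iff {z : K} {g : AmalgamatedProduct φ} :
    SameType φ z g⁻¹ ↔ SameType φ z g :=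
  ⟨fun h => by simpa using h.inv, SameType.inv⟩

theorem GoodFellows.not_sameType {x y : K} (hxy : GoodFellows H x y) {g : AmalgamatedProduct φ}
    (hx : SameType φ x g) : ¬ SameType φ y g := by
  rintro ⟨δ, _, ⟨c', hc', rfl⟩, _, ⟨d', hd', rfl⟩, h⟩
  obtain ⟨ε, _, ⟨c, hc, rfl⟩, _, ⟨d, hd, rfl⟩, rfl⟩ := hx
  simp only [← map_mul] at h
  refine Set.disjoint_left.1 (hxy.2.2 ε δ) (DoubleCoset.mem_doubleCoset.2 ⟨c, hc, d, hd, rfl⟩)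
    (DoubleCoset.mem_doubleCoset.2 ⟨c', hc', d', hd', ofLeft_injective φ h⟩)

/-- Two shifts with a common long initial part have matching letters there. -/
theorem exists_match {s₁ s₂ : ℤ → AmalgamatedProduct φ}
    (hs₁ : AltSeq (factor φ) (base φ) s₁) (hs₂ : AltSeq (factor φ) (base φ) s₂)
    {i₁ i₂ : ℤ} {b₁ b₂ : AmalgamatedProduct φ}
    (h : ∀ j, 1 ≤ j → j ≤ 601 → (b₁ * (seg s₁ i₁ j).prod)⁻¹ * (b₂ * (seg s₂ i₂ j).prod) ∈ base φ) :
    ∃ d p, i₂ = i₁ + 2 * d ∧ ∀ q, p ≤ q → q < p + 300 → ∀ z,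
      SameType φ z (s₁ (2 * q)) → SameType φ z (s₂ (2 * (q + d))) := by
  have hF := isAmalgam φ
  -- The two discrepancies before and after a letter lie in `H`, and their quotient relates the
  -- letters; this uses prefixes of lengths `j` and `j + 1`, so 601 prefixes yield 600 letters.
  have key : ∀ j : ℕ, 1 ≤ j → j ≤ 600 → ∃ c ∈ base φ, ∃ d ∈ base φ,
      s₂ (i₂ + j) = c * s₁ (i₁ + j) * d := by
    intro j h1 h2
    refine ⟨_, inv_mem (h j h1 (by omega)), _, h (j + 1) (by omega) (by omega), ?_⟩
    rw [seg_succ_right, seg_succ_right, List.prod_append, List.prod_append, List.prod_singleton,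
      List.prod_singleton]
    group
  have hside : side (i₁ + 1) = side (i₂ + 1) := by
    obtain ⟨c, hc, d, hd, e⟩ := key 1 le_rfl (by omega)
    have h1 : s₂ (i₂ + 1) ∈ factor φ (side (i₁ + 1)) := by
      have := (hs₁ (i₁ + 1)).1
      rw [Nat.cast_one] at e
      rw [e]
      exact mul_mem (mul_mem (hF.le _ hc) this) (hF.le _ hd)
    by_contra hne
    have hne' : side (i₂ + 1) = !side (i₁ + 1) := by
      revert hne; cases side (i₁ + 1) <;> cases side (i₂ + 1) <;> simp
    exact (hs₂ (i₂ + 1)).2 (hF.mem_of_mem _ _ h1 (hne' ▸ (hs₂ (i₂ + 1)).1))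
  have hmod : (i₂ - i₁) % 2 = 0 := by
    unfold side at hside
    rw [decide_eq_decide] at hside
    omega
  -- The 300 values of `q` from `(i₁ + 2) / 2` on are those with `1 ≤ 2 * q - i₁ ≤ 600`.
  refine ⟨(i₂ - i₁) / 2, (i₁ + 2) / 2, by omega, fun q hq hq' z hz => ?_⟩
  obtain ⟨c, hc, d, hd, e⟩ := key (2 * q - i₁).toNat (by omega) (by omega)
  rw [show i₁ + ((2 * q - i₁).toNat : ℤ) = 2 * q by omega,
    show i₂ + ((2 * q - i₁).toNat : ℤ) = 2 * (q + (i₂ - i₁) / 2) by omega] at e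
  rw [e]
  exact hz.mul_mul hc hd

/-- A long common initial part of two shifts of the same periodic sequence, in phase, forces the
shifts to agree, if the sequence has letters that conjugate the amalgamated subgroup off itself. -/
theorem eq_of_inPhase {s : ℤ → AmalgamatedProduct φ} {n : ℕ}
    (hper : Function.Periodic s (n : ℤ)) {w₁ w₂ : AmalgamatedProduct φ} {i₁ i₂ : ℤ}
    {b₁ b₂ : AmalgamatedProduct φ} (h₁ : IsShift (factor φ) (base φ) s n w₁ i₁ b₁)
    (h₂ : IsShift (factor φ) (base φ) s n w₂ i₂ b₂)
    (h : ∀ j, 1 ≤ j → j ≤ 601 → (b₁ * (seg s i₁ j).prod)⁻¹ * (b₂ * (seg s i₂ j).prod) ∈ base φ)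
    (hmal : ∀ q, q % 2 = 1 → ∀ g ∈ base φ, (s q)⁻¹ * g * s q ∈ base φ → g = 1)
    (hi : (n : ℤ) ∣ i₂ - i₁) : w₁ = w₂ := by
  obtain ⟨m, hm⟩ := hi
  obtain rfl : i₂ = i₁ + m * n := by linarith
  have hseg : ∀ j : ℕ, ∀ k, seg s (i₁ + m * n + j) k = seg s (i₁ + j) k := by
    intro j k
    rw [add_right_comm]
    exact seg_congr (hper.int_mul m) _ _
  have hseg0 := hseg 0
  simp only [Nat.cast_zero, add_zero] at hseg0
  -- One of the two letters after the first is at an odd place; the discrepancies on both sides of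
  -- it lie in `H`, so `hmal` makes the one before it trivial.
  obtain ⟨j, hj1, hj2, hj⟩ : ∃ j : ℕ, 1 ≤ j ∧ j ≤ 2 ∧ (i₁ + j) % 2 = 1 := by
    rcases Int.emod_two_eq_zero_or_one i₁ with h | h
    · exact ⟨1, le_rfl, by omega, by push_cast; omega⟩
    · exact ⟨2, by omega, le_rfl, by push_cast; omega⟩
  have e : b₁ * (seg s i₁ j).prod = b₂ * (seg s i₁ j).prod := by
    have h3 := h j hj1 (by omega)
    have h4 := h (j + 1) (by omega) (by omega)
    rw [hseg0] at h3 h4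
    have := hmal _ hj _ h3 (by
      rw [seg_succ_right, List.prod_append, List.prod_singleton] at h4
      convert h4 using 1; group)
    exact (inv_mul_eq_one.1 this)
  rw [h₁.eq_conj hper j, h₂.eq_conj hper j, hseg, hseg0, e]

end Pieces

/-! ### The relator, its symmetrized closure and its pieces -/

section Relator

variable {K L : Type u} [Group K] [Group L] {H : Subgroup K} {H' : Subgroup L} (φ : H ≃* H')
  (x y h : K) (a : L)

/-- The letters of the relator, continued periodically. -/
noncomputable def letter (q : ℤ) : AmalgamatedProduct φ :=
  if q % 2 = 1 then ofRight φ a else ofLeft φ (leftLetter x y h (q / 2))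

theorem letter_even (p : ℤ) : letter φ x y h a (2 * p) = ofLeft φ (leftLetter x y h p) := by
  rw [letter, if_neg (by omega)]
  simp

theorem letter_odd {q : ℤ} (hq : q % 2 = 1) : letter φ x y h a q = ofRight φ a := if_pos hq

theorem letter_periodic : Function.Periodic (letter φ x y h a) ((6640 : ℕ) : ℤ) := by
  intro q
  have h1 : (q + ((6640 : ℕ) : ℤ)) % 2 = q % 2 := by omega
  have h2 : (q + ((6640 : ℕ) : ℤ)) / 2 = q / 2 + 3320 := by omega
  rw [letter, letter, h1, h2, leftLetter_periodic]

theorem prod_seg_letter_const (z : K) (p : ℤ) (n : ℕ)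
    (hz : ∀ t : ℕ, t < n → leftLetter x y h (p + t) = z) :
    (seg (letter φ x y h a) (2 * p) (2 * n)).prod = (ofLeft φ z * ofRight φ a) ^ n := by
  induction n with
  | zero => simp [seg]
  | succ n ih =>
    rw [pow_succ, ← ih fun t ht => hz t (by omega), mul_add, seg_add, List.prod_append]
    congr 1
    rw [show 2 * p + ((2 * n : ℕ) : ℤ) = 2 * (p + n) by push_cast; ring]
    rw [seg, seg, letter_even, hz n (by omega), letter_odd φ x y h a (by omega)]
    simp [seg]

theorem relator_eq : relator φ x y h a = (seg (letter φ x y h a) 0 6640).prod := by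
  -- Block `m + 2` is the first one not yet written after `h a y a` and `m` further blocks; each
  -- position among the letters from `K` accounts for two letters.
  have key : ∀ m : ℕ, m ≤ 79 → ∀ n : ℕ, (n : ℤ) = 2 * blk (m + 2) →
      (seg (letter φ x y h a) 0 n).prod =
        ofLeft φ h * ofRight φ a * (ofLeft φ y * ofRight φ a) *
          ((List.range m).map fun k =>
            ofLeft φ x * ofRight φ a * (ofLeft φ y * ofRight φ a) ^ (k + 2)).prod := by
    intro m
    induction m with
    | zero =>
      intro _ n hn
      have h2 : blk (0 + 2) = 2 := blk_eq _ (by norm_num)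
      obtain rfl : n = 2 * 1 + 2 * 1 := by omega
      rw [seg_add, List.prod_append]
      have e1 := prod_seg_letter_const φ x y h a h 0 1 fun t ht => by
        obtain rfl : t = 0 := by omega
        simp [leftLetter_zero]
      have e2 := prod_seg_letter_const φ x y h a y 1 1 fun t ht => by
        obtain rfl : t = 0 := by omega
        have := leftLetter_blk_add x y h 0 (k := 1) (t := 1) le_rfl (by omega) le_rfl le_rfl
        simpa [blk] using this
      simp only [mul_zero, pow_one] at e1 e2
      rw [e1, show (0 : ℤ) + ((2 * 1 : ℕ) : ℤ) = 2 * 1 by norm_num, e2]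
      simp
    | succ m ih =>
      intro hm n hn
      have hb : blk (m + 1 + 2) = blk (m + 2) + (m + 3) := by
        rw [show m + 1 + 2 = (m + 2) + 1 by ring, blk]; push_cast; ring
      have h0 := (blk_bounds (show 1 ≤ m + 2 by omega) (by omega)).1
      obtain ⟨k, hk⟩ := Int.eq_ofNat_of_zero_le h0
      obtain rfl : n = 2 * k + (2 * 1 + 2 * (m + 2)) := by omega
      rw [seg_add, List.prod_append, ih (by omega) (2 * k) (by push_cast; omega), List.range_succ,
        List.map_append, List.prod_append, List.map_singleton, List.prod_singleton, seg_add,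
        List.prod_append]
      have e1 := prod_seg_letter_const φ x y h a x (blk (m + 2)) 1 fun t ht => by
        obtain rfl : t = 0 := by omega
        simpa using leftLetter_blk x y h 0 (show 2 ≤ m + 2 by omega) (by omega)
      have e2 := prod_seg_letter_const φ x y h a y (blk (m + 2) + 1) (m + 2) fun t ht => by
        have := leftLetter_blk_add x y h 0 (show 1 ≤ m + 2 by omega) (by omega)
          (show 1 ≤ t + 1 by omega) (by omega)
        convert this using 2; push_cast; ring
      rw [pow_one] at e1
      rw [show (0 : ℤ) + ((2 * k : ℕ) : ℤ) = 2 * blk (m + 2) by push_cast; omega, e1,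
        show 2 * blk (m + 2) + ((2 * 1 : ℕ) : ℤ) = 2 * (blk (m + 2) + 1) by push_cast; ring, e2,
        mul_assoc _ (List.prod _)]
  exact (key 79 le_rfl 6640 (by
    rw [show blk (79 + 2) = 3320 from blk_eq _ (by norm_num)]; norm_num)).symm

variable {x y h a}

theorem altSeq_letter (hxy : GoodFellows H x y) (ha : a ∉ H') (hh : h ∉ H) :
    AltSeq (factor φ) (base φ) (letter φ x y h a) := by
  intro q
  unfold letter side
  split_ifs with hq
  · simp only [hq, decide_true]
    exact ⟨⟨a, rfl⟩, by rwa [ofRight_mem_base]⟩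
  · simp only [hq, decide_false]
    refine ⟨⟨_, rfl⟩, ?_⟩
    rw [ofLeft_mem_base]
    rcases leftLetter_cases x y h (q / 2) with e | e | e <;> rw [e]
    exacts [hh, hxy.1, hxy.2.1]

theorem AltSeq.inv_neg {G : Type u} [Group G] {F : Bool → Subgroup G} {C : Subgroup G}
    {s : ℤ → G} (hs : AltSeq F C s) : AltSeq F C fun q => (s (-q))⁻¹ := by
  intro q
  have : side q = side (-q) := by unfold side; rw [decide_eq_decide]; omega
  simpa [this] using hs (-q)

theorem periodic_inv_neg {G : Type u} [Group G] {s : ℤ → G} {n : ℤ}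
    (hs : Function.Periodic s n) : Function.Periodic (fun q => (s (-q))⁻¹) n := by
  intro q
  have := hs (-q - n)
  simp only [sub_add_cancel] at this
  simp [this, sub_eq_add_neg, add_comm]

variable (a) in
/-- The letters of the relator (for `false`) or of its inverse (for `true`). -/
noncomputable def signedLetter (x y h : K) : Bool → ℤ → AmalgamatedProduct φ
  | false => letter φ x y h a
  | true => fun q => (letter φ x y h a (-q))⁻¹

theorem altSeq_signedLetter (hxy : GoodFellows H x y) (ha : a ∉ H') (hh : h ∉ H) (e : Bool) :
    AltSeq (factor φ) (base φ) (signedLetter φ a x y h e) := by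
  cases e
  · exact altSeq_letter φ hxy ha hh
  · exact (altSeq_letter φ hxy ha hh).inv_neg

theorem signedLetter_periodic (e : Bool) :
    Function.Periodic (signedLetter φ a x y h e) ((6640 : ℕ) : ℤ) := by
  cases e
  · exact letter_periodic φ x y h a
  · exact periodic_inv_neg (letter_periodic φ x y h a)

theorem sameType_signedLetter_true (z : K) (p : ℤ) :
    SameType φ z (signedLetter φ a x y h true (2 * p)) ↔
      SameType φ z (ofLeft φ (leftLetter x y h (-p))) := by
  rw [signedLetter, sameType_inv_iff, ← letter_even φ x y h a, mul_neg]

theorem sameType_signedLetter_false (z : K) (p : ℤ) :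
    SameType φ z (signedLetter φ a x y h false (2 * p)) ↔
      SameType φ z (ofLeft φ (leftLetter x y h p)) := by
  rw [signedLetter, ← letter_even φ x y h a]

theorem eq_and_dvd_of_match (hxy : GoodFellows H x y) (e₁ e₂ : Bool) {d p : ℤ}
    (hm : ∀ q, p ≤ q → q < p + 300 → ∀ z, SameType φ z (signedLetter φ a x y h e₁ (2 * q)) →
      SameType φ z (signedLetter φ a x y h e₂ (2 * (q + d)))) : e₁ = e₂ ∧ (3320 : ℤ) ∣ d := by
  have hX := sameType_self (φ := φ) x
  have hY := sameType_self (φ := φ) y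
  have hdisj : ∀ g : K, SameType φ x (ofLeft φ g) → ¬ SameType φ y (ofLeft φ g) :=
    fun g => GoodFellows.not_sameType hxy
  cases e₁ <;> cases e₂ <;>
    simp only [sameType_signedLetter_true, sameType_signedLetter_false] at hm
  · exact ⟨rfl, dvd_of_window (h := h) hX hY hdisj (fun q h1 h2 => hm q h1 h2 x)
      fun q h1 h2 => hm q h1 h2 y⟩
  · refine (not_window_reversed (h := h) (d := -d) (p := p) hX hY hdisj (fun q h1 h2 h3 => ?_)
      fun q h1 h2 h3 => ?_).elim
    · convert hm q h1 h2 x h3 using 3; ring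
    · convert hm q h1 h2 y h3 using 3; ring
  -- Negating the index turns the window from `p` to `p + 299` into the one from `-p - 299` to `-p`.
  · have hm' : ∀ q, -p - 299 ≤ q → q < -p - 299 + 300 → ∀ z,
        SameType φ z (ofLeft φ (leftLetter x y h q)) →
        SameType φ z (ofLeft φ (leftLetter x y h (d - q))) := by
      intro q h1 h2 z h3
      convert hm (-q) (by omega) (by omega) z (by rwa [neg_neg]) using 3; ring
    exact (not_window_reversed (h := h) hX hY hdisj (fun q h1 h2 => hm' q h1 h2 x)
      fun q h1 h2 => hm' q h1 h2 y).elim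
  · have hm' : ∀ q, -p - 299 ≤ q → q < -p - 299 + 300 → ∀ z,
        SameType φ z (ofLeft φ (leftLetter x y h q)) →
        SameType φ z (ofLeft φ (leftLetter x y h (q + -d))) := by
      intro q h1 h2 z h3
      convert hm (-q) (by omega) (by omega) z (by rwa [neg_neg]) using 3; ring
    exact ⟨rfl, (dvd_neg.1 (dvd_of_window (h := h) hX hY hdisj
      (fun q h1 h2 => hm' q h1 h2 x) fun q h1 h2 => hm' q h1 h2 y))⟩

theorem signedLetter_malnormal
    (haH : ∀ g ∈ H', a⁻¹ * g * a ∈ H' → a⁻¹ * g * a = 1) (e : Bool) (q : ℤ) (hq : q % 2 = 1)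
    (g : AmalgamatedProduct φ) (hg : g ∈ base φ)
    (hc : (signedLetter φ a x y h e q)⁻¹ * g * signedLetter φ a x y h e q ∈ base φ) : g = 1 := by
  have key : ∀ g ∈ base φ, (ofRight φ a)⁻¹ * g * ofRight φ a ∈ base φ → g = 1 := by
    intro g hg hc
    obtain ⟨g, rfl⟩ : ∃ g' : L, ofRight φ g' = g := (isAmalgam φ).le true hg
    rw [← map_inv, ← map_mul, ← map_mul, ofRight_mem_base] at hc
    rw [ofRight_mem_base] at hg
    have := haH g hg hc
    rw [mul_assoc, inv_mul_eq_one, eq_comm, mul_eq_right] at this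
    rw [this, map_one]
  cases e
  · rw [signedLetter, letter_odd φ x y h a hq] at hc
    exact key g hg hc
  · dsimp only [signedLetter] at hc
    rw [letter_odd φ x y h a (by omega), inv_inv] at hc
    -- Here the letter is `a⁻¹`, so the roles are exchanged: `a g a⁻¹` is the element of `H` whose
    -- conjugate by `a` stays in `H`.
    have := key _ hc (by simpa [mul_assoc] using hg)
    rwa [mul_inv_eq_one, mul_eq_left] at this

theorem isWeaklyCyclicallyReduced_relator (hxy : GoodFellows H x y) (ha : a ∉ H') (hh : h ∉ H) :
    IsWeaklyCyclicallyReduced (relator φ x y h a) := by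
  refine ⟨_, ((altSeq_letter φ hxy ha hh).alt_seg 0 6640).isNormalForm (relator_eq φ x y h a).symm,
    Or.inr fun g hg g' hg' hmem => ?_⟩
  have e1 : g = ofRight φ a := by
    rw [show 6640 = 6639 + 1 from rfl, seg_succ_right, List.getLast?_concat,
      letter_odd φ x y h a (by norm_num)] at hg
    simpa using hg.symm
  have e2 : g' = ofLeft φ h := by
    have := letter_even φ x y h a 0
    rw [mul_zero, leftLetter_zero] at this
    rw [show 6640 = 6639 + 1 from rfl, seg, List.head?_cons, this] at hg'
    simpa using hg'.symm
  subst e1 e2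
  have h1 : ofLeft φ h ∈ factor φ true := by
    have h2 := (isAmalgam φ).le true hmem
    rwa [Subgroup.mul_mem_cancel_left _ (show ofRight φ a ∈ factor φ true from ⟨a, rfl⟩)] at h2
  have h2 := (isAmalgam φ).mem_of_mem (ofLeft φ h) true h1 ⟨h, rfl⟩
  rw [ofLeft_mem_base] at h2
  exact hh h2

theorem exists_isShift_signedLetter (hxy : GoodFellows H x y) (ha : a ∉ H') (hh : h ∉ H)
    {w : AmalgamatedProduct φ} (hw : w ∈ symmetrizedClosure (relator φ x y h a)) :
    ∃ e i b, IsShift (factor φ) (base φ) (signedLetter φ a x y h e) 6640 w i b := by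
  obtain ⟨hcyc, hc⟩ := (isSymmetrized_symmetrizedClosure
    (isWeaklyCyclicallyReduced_relator φ hxy ha hh)).2 w hw
  have main : ∀ e i₀, IsConj (seg (signedLetter φ a x y h e) i₀ 6640).prod w →
      ∃ e i b, IsShift (factor φ) (base φ) (signedLetter φ a x y h e) 6640 w i b :=
    fun e i₀ h' => ⟨e, exists_isShift (isAmalgam φ) (altSeq_signedLetter φ hxy ha hh e)
      (by decide) (by norm_num) (signedLetter_periodic φ e) hcyc.cycRed h'⟩
  rw [relator_eq] at hc
  rcases hc with hc | hc
  · exact main false 0 hc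
  · rw [prod_seg_inv] at hc
    exact main true _ hc

theorem length_mem_symmetrizedClosure (hxy : GoodFellows H x y) (ha : a ∉ H') (hh : h ∉ H)
    {w : AmalgamatedProduct φ} (hw : w ∈ symmetrizedClosure (relator φ x y h a)) :
    length w = 6640 ∨ length w = 6641 := by
  obtain ⟨e, i, b, hs⟩ := exists_isShift_signedLetter φ hxy ha hh hw
  obtain ⟨t, ht, hp, hlen⟩ := hs.exists_normalForm (isAmalgam φ)
    (altSeq_signedLetter φ hxy ha hh e) (by decide) (by norm_num)
  rw [(ht.isNormalForm hp).length_eq, List.length_cons, List.length_append, length_seg]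
  omega

theorem length_le_of_isPiece (hxy : GoodFellows H x y) (ha : a ∉ H')
    (haH : ∀ g ∈ H', a⁻¹ * g * a ∈ H' → a⁻¹ * g * a = 1) (hh : h ∉ H)
    {b : AmalgamatedProduct φ} (hb : IsPiece (symmetrizedClosure (relator φ x y h a)) b) :
    length b ≤ 601 := by
  by_contra! hlt
  obtain ⟨r₁, hr₁, r₂, hr₂, hne, c₁, c₂, hc₁, hc₂, hsr₁, hsr₂⟩ := hb
  -- Without a normal form the length would be `sInf ∅ = 0`.
  obtain ⟨u, hu⟩ : ∃ u, IsNormalForm u b := by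
    by_contra! hno
    simp [length, hno] at hlt
  rw [hu.length_eq] at hlt
  -- The piece has at least 602 letters and only the last may merge with the cofactor, so the first
  -- 601 are letters of `r`.
  have shift : ∀ r ∈ symmetrizedClosure (relator φ x y h a), ∀ c, r = b * c → IsSemireduced b c →
      ∃ e i d, IsShift (factor φ) (base φ) (signedLetter φ a x y h e) 6640 r i d ∧
        ∀ j, 1 ≤ j → j ≤ 601 →
          (u.take j).prod⁻¹ * (d * (seg (signedLetter φ a x y h e) i j).prod) ∈ base φ := by
    intro r hr c hc hsr
    obtain ⟨e, i, d, hs⟩ := exists_isShift_signedLetter φ hxy ha hh hr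
    obtain ⟨k, m, hm, hp, htake⟩ := hsr.exists_alt hu (by omega)
    refine ⟨e, i, d, hs, fun j h1 h2 => ?_⟩
    rw [← htake j (by omega)]
    exact hs.prefix_mem (isAmalgam φ) (altSeq_signedLetter φ hxy ha hh e) (by decide)
      (by norm_num) hm (hp.trans hc.symm) h1 (by omega)
  obtain ⟨e₁, i₁, d₁, hs₁, hp₁⟩ := shift r₁ hr₁ c₁ hc₁ hsr₁
  obtain ⟨e₂, i₂, d₂, hs₂, hp₂⟩ := shift r₂ hr₂ c₂ hc₂ hsr₂
  have hp : ∀ j, 1 ≤ j → j ≤ 601 → (d₁ * (seg (signedLetter φ a x y h e₁) i₁ j).prod)⁻¹ *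
      (d₂ * (seg (signedLetter φ a x y h e₂) i₂ j).prod) ∈ base φ := by
    intro j h1 h2
    convert mul_mem (inv_mem (hp₁ j h1 h2)) (hp₂ j h1 h2) using 1
    group
  obtain ⟨d, p, rfl, hm⟩ := exists_match (altSeq_signedLetter φ hxy ha hh e₁)
    (altSeq_signedLetter φ hxy ha hh e₂) hp
  obtain ⟨rfl, hd⟩ := eq_and_dvd_of_match φ hxy e₁ e₂ hm
  exact hne (eq_of_inPhase (signedLetter_periodic φ e₁) hs₁ hs₂ hp
    (fun q hq g hg hc => signedLetter_malnormal φ haH e₁ q hq g hg hc) (by omega))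

end Relator

end Amalgam

theorem lemmaA2 {K L : Type u} [Group K] [Group L] (H : Subgroup K) (H' : Subgroup L)
    (φ : H ≃* H') (x y h : K) (a : L) (hxy : GoodFellows H x y) (ha : a ∉ H')
    (haH : ∀ g ∈ H', a⁻¹ * g * a ∈ H' → a⁻¹ * g * a = 1) (hh : h ∉ H) :
    Amalgam.SmallCancellation (1 / 10)
        (Amalgam.symmetrizedClosure (Amalgam.relator φ x y h a)) ∧
      (∀ b, Amalgam.IsPiece (Amalgam.symmetrizedClosure (Amalgam.relator φ x y h a)) b →
        Amalgam.length b ≤ 601) ∧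
      ∀ r ∈ Amalgam.symmetrizedClosure (Amalgam.relator φ x y h a),
        Amalgam.length r = 6640 ∨ Amalgam.length r = 6641 := by
  have hlen := fun r hr => Amalgam.length_mem_symmetrizedClosure φ hxy ha hh (w := r) hr
  have hpiece := fun b hb => Amalgam.length_le_of_isPiece φ hxy ha haH hh (b := b) hb
  have hlen' : ∀ r ∈ Amalgam.symmetrizedClosure (Amalgam.relator φ x y h a),
      (6640 : ℝ) ≤ Amalgam.length r := by
    intro r hr
    have : 6640 ≤ Amalgam.length r := by rcases hlen r hr with e | e <;> omega
    exact_mod_cast this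
  refine ⟨⟨(Amalgam.isSymmetrized_symmetrizedClosure
    (Amalgam.isWeaklyCyclicallyReduced_relator φ hxy ha hh)).1, ?_, ?_⟩, hpiece, hlen⟩
  -- The bound is 601 < 664 = 6640/10.
  · intro r hr b c hb _ _
    have h1 : (Amalgam.length b : ℝ) ≤ 601 := by exact_mod_cast hpiece b hb
    linarith [hlen' r hr]
  · intro r hr
    linarith [hlen' r hr]
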